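/- Let $n_1,n_2,m,k\ge 1$ be integers and, for $i=1,2$, let $A_i\in\mathbb R^{n_i\times n_i}$, $B_i\in\mathbb R^{n_i\times m}$, $C_i\in\mathbb R^{k\times n_i}$, $G_i\in\mathbb R^{k\times m}$. Consider the linear control systems $$S_i:\quad x'(t)=A_ix(t)+B_iu(t),\qquad y(t)=C_ix(t)+G_iu(t).$$ Let $T>0$. For $x_{i0}\in\mathbb R^{n_i}$ and $u\in L^1(0,T;\mathbb R^m)$ let $y_i$ be the output on $[0,T]$ of $S_i$ for the input $u$ and the (absolutely continuous) solution with $x(0)=x_{i0}$. The systems $S_1$ and $S_2$ are called distinguishable on $[0,T]$ if for every nonzero triple $(x_{10},x_{20},u)\in\mathbb R^{n_1}\times\mathbb R^{n_2}\times L^1(0,T;\mathbb R^m)$ the outputs $y_1$ and $y_2$ are not identical on $[0,T]$ (as elements of $L^1(0,T;\mathbb R^k)$, that is, up to equality almost everywhere). Put $$A=\begin{pmatrix}A_1&0\\0&A_2\end{pmatrix},\quad B=\begin{pmatrix}B_1\\B_2\end{pmatrix},\quad C=\begin{pmatrix}C_1&-C_2\end{pmatrix},\quad G=G_1-G_2 .$$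 Then, for every $T>0$, $S_1$ and $S_2$ are distinguishable on $[0,T]$ if and only if for every $\lambda\in\mathbb C$ the complex matrix $$\mathcal M_\lambda=\begin{pmatrix}C&G\\ C(A-\lambda I)&CB\\ C(A-\lambda I)^2&C(A-\lambda I)B\\ \vdots&\vdots\\ C(A-\lambda I)^{n_1+n_2}&C(A-\lambda I)^{n_1+n_2-1}B\end{pmatrix}$$ has full column rank $n_1+n_2+m$. -/

import Mathlib

open MeasureTheory

/-- The data of a time-invariant linear control system `x' = A x + B u`, `y = C x + G u` with
state space `ℝⁿ`, input space `ℝᵐ` and output space `ℝᵏ`. -/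
structure LinearSystem (n m k : ℕ) where
  A : Matrix (Fin n) (Fin n) ℝ
  B : Matrix (Fin n) (Fin m) ℝ
  C : Matrix (Fin k) (Fin n) ℝ
  G : Matrix (Fin k) (Fin m) ℝ

/-- The input space `L¹(0,T;ℝᵐ)`, whose elements are functions up to equality almost everywhere. -/
abbrev InputSpace (T : ℝ) (m : ℕ) : Type :=
  Lp (Fin m → ℝ) 1 (volume.restrict (Set.Icc 0 T))

namespace LinearSystem

variable {n n₁ n₂ m k : ℕ}

/-- `x` is the (Carathéodory) solution on `[0,T]` of `x' = A x + B u`, `x(0) = x₀`: it is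
continuous and satisfies the integrated equation
`x(t) = x₀ + ∫₀ᵗ (A x(s) + B u(s)) ds` for `t ∈ [0,T]`. The integrand is integrable, because `x`
is continuous and `u` is in `L¹`. -/
def IsSolution (S : LinearSystem n m k) (T : ℝ) (x₀ : Fin n → ℝ) (u : InputSpace T m)
    (x : ℝ → Fin n → ℝ) : Prop :=
  ContinuousOn x (Set.Icc 0 T) ∧
    ∀ t ∈ Set.Icc 0 T, x t = x₀ + ∫ s in (0 : ℝ)..t, (S.A.mulVec (x s) + S.B.mulVec (u s))

/-- The output `y = C x + G u` along the state trajectory `x`. -/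
noncomputable def output (S : LinearSystem n m k) {T : ℝ} (u : InputSpace T m) (x : ℝ → Fin n → ℝ) (t : ℝ) :
    Fin k → ℝ :=
  S.C.mulVec (x t) + S.G.mulVec (u t)

/-- `S₁` and `S₂` are distinguishable on `[0,T]`: for every nonzero triple `(x₁₀, x₂₀, u)` the
corresponding outputs are not identical on `[0,T]`. As `u` is an element of `L¹`, outputs are
functions up to equality almost everywhere, and are compared as such. -/
def Distinguishable (S₁ : LinearSystem n₁ m k) (S₂ : LinearSystem n₂ m k) (T : ℝ) : Prop :=
  ∀ (x₁₀ : Fin n₁ → ℝ) (x₂₀ : Fin n₂ → ℝ) (u : InputSpace T m), (x₁₀, x₂₀, u) ≠ 0 →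
    ∀ (x₁ : ℝ → Fin n₁ → ℝ) (x₂ : ℝ → Fin n₂ → ℝ),
      S₁.IsSolution T x₁₀ u x₁ → S₂.IsSolution T x₂₀ u x₂ →
        ¬ (S₁.output u x₁ =ᵐ[volume.restrict (Set.Icc 0 T)] S₂.output u x₂)

/-- The block matrix `A = diag(A₁, A₂)`. -/
def jointA (S₁ : LinearSystem n₁ m k) (S₂ : LinearSystem n₂ m k) :
    Matrix (Fin n₁ ⊕ Fin n₂) (Fin n₁ ⊕ Fin n₂) ℝ :=
  Matrix.fromBlocks S₁.A 0 0 S₂.A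

/-- The block matrix `B` with `B₁` above `B₂`. -/
def jointB (S₁ : LinearSystem n₁ m k) (S₂ : LinearSystem n₂ m k) :
    Matrix (Fin n₁ ⊕ Fin n₂) (Fin m) ℝ :=
  Matrix.fromRows S₁.B S₂.B

/-- The block matrix `C = (C₁, -C₂)`. -/
def jointC (S₁ : LinearSystem n₁ m k) (S₂ : LinearSystem n₂ m k) :
    Matrix (Fin k) (Fin n₁ ⊕ Fin n₂) ℝ :=
  Matrix.fromCols S₁.C (-S₂.C)

/-- The matrix `G = G₁ - G₂`. -/
def jointG (S₁ : LinearSystem n₁ m k) (S₂ : LinearSystem n₂ m k) :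
    Matrix (Fin k) (Fin m) ℝ :=
  S₁.G - S₂.G

/-- For complex matrices `A`, `B`, `C`, `G`, the block row with index `j` of `M_μ`: it is `(C, G)`
for `j = 0` and `(C (A - μ I)^j, C (A - μ I)^(j-1) B)` for `j ≥ 1`. -/
def blockRow {ι : Type} [Fintype ι] [DecidableEq ι] (A : Matrix ι ι ℂ) (B : Matrix ι (Fin m) ℂ)
    (C : Matrix (Fin k) ι ℂ) (G : Matrix (Fin k) (Fin m) ℂ) (μ : ℂ) :
    ℕ → Matrix (Fin k) (ι ⊕ Fin m) ℂ
  | 0 => Matrix.fromCols C G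
  | j + 1 => Matrix.fromCols (C * (A - μ • 1) ^ (j + 1)) (C * (A - μ • 1) ^ j * B)

/-- The complex matrix `M_μ`, whose block rows are those with index `j = 0, 1, …, n₁ + n₂`; the
row with index `(j, i)` is the `i`-th row of the `j`-th block row. -/
noncomputable def testMatrix (S₁ : LinearSystem n₁ m k) (S₂ : LinearSystem n₂ m k) (μ : ℂ) :
    Matrix (Fin (n₁ + n₂ + 1) × Fin k) ((Fin n₁ ⊕ Fin n₂) ⊕ Fin m) ℂ :=
  Matrix.of fun p =>
    blockRow ((jointA S₁ S₂).map Complex.ofReal) ((jointB S₁ S₂).map Complex.ofReal)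
      ((jointC S₁ S₂).map Complex.ofReal) ((jointG S₁ S₂).map Complex.ofReal) μ p.1 p.2

end LinearSystem

/-! Write w = (ξ, v), H = (C G), and let E have block rows (A - μI, B) and (0, 0). The block row of
M_μ with index j is H E^j, and by Cayley-Hamilton a kernel vector of M_μ is killed by every H E^j.
Then e^{μt} e^{tE} w is a trajectory with input e^{μt} v and zero joint output; the real part of a
scalar multiple of it refutes distinguishability (`exists_trajectory_of_blockRow_mulVec_eq_zero`).

Conversely, let (x, u) be a nonzero trajectory of the joint system with zero output, and V the
complex span of x([0, T]). Inputs can keep the state in V and the output at zero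
(`exists_input_of_mem_span_trajectory`). If V ≠ 0, they can be chosen as a linear feedback, and an
eigenvector of the closed loop on V gives Aξ + Bv = μξ, Cξ + Gv = 0
(`exists_eigen_of_controlledInvariant`), that is, E w = 0 and H w = 0. If V = 0, then x = 0, and
some nonzero value v of u has Bv = 0 and Gv = 0; take ξ = 0. -/

open Matrix Filter Topology

/-! ### Linear algebra preliminaries -/

namespace Matrix

/-- A matrix over a field has full column rank iff it is injective on column vectors. -/
theorem rank_eq_card_iff_forall_mulVec_eq_zero {p q K : Type*} [Fintype p] [Fintype q] [DecidableEq q]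
    [Field K] (M : Matrix p q K) :
    M.rank = Fintype.card q ↔ ∀ w, M *ᵥ w = 0 → w = 0 := by
  have h := LinearMap.finrank_range_add_finrank_ker M.mulVecLin
  rw [Module.finrank_pi] at h
  have h2 : Module.finrank K (LinearMap.ker M.mulVecLin) = 0 ↔ ∀ w, M *ᵥ w = 0 → w = 0 := by
    rw [Submodule.finrank_eq_zero, LinearMap.ker_eq_bot']
    rfl
  rw [← h2, Matrix.rank]
  omega

/-- Observability needs only the first `card ι` powers of the state matrix. -/
theorem mul_pow_mulVec_eq_zero_of_lt_card {ι κ K : Type*} [Fintype ι] [DecidableEq ι] [Field K]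
    (D : Matrix ι ι K) (C : Matrix κ ι K) (η : ι → K)
    (h : ∀ j < Fintype.card ι, (C * D ^ j) *ᵥ η = 0) (j : ℕ) : (C * D ^ j) *ᵥ η = 0 := by
  -- Cayley-Hamilton: only the remainder of X^j modulo the characteristic polynomial matters.
  rw [Matrix.pow_eq_aeval_mod_charpoly]
  set q := Polynomial.X ^ j %ₘ D.charpoly with hq
  have hdeg : q.degree < Fintype.card ι := by
    rw [← Matrix.charpoly_degree_eq_dim D]
    exact Polynomial.degree_modByMonic_lt _ D.charpoly_monic
  rw [Polynomial.aeval_eq_sum_range, Matrix.mul_sum, Matrix.sum_mulVec]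
  refine Finset.sum_eq_zero fun i _ => ?_
  rw [Matrix.mul_smul, Matrix.smul_mulVec]
  by_cases hi : i < Fintype.card ι
  · rw [h i hi, smul_zero]
  · rw [Polynomial.coeff_eq_zero_of_degree_lt (hdeg.trans_le (by exact_mod_cast not_lt.mp hi)),
      zero_smul]

theorem fromBlocks_zero_pow_succ {ι κ R : Type*} [Fintype ι] [DecidableEq ι] [Fintype κ]
    [DecidableEq κ] [CommRing R] (D : Matrix ι ι R) (B : Matrix ι κ R) (j : ℕ) :
    (fromBlocks D B 0 0 : Matrix (ι ⊕ κ) (ι ⊕ κ) R) ^ (j + 1) =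
      fromBlocks (D ^ (j + 1)) (D ^ j * B) 0 0 := by
  induction j with
  | zero => simp
  | succ j ih =>
    rw [pow_succ', ih, fromBlocks_multiply]
    simp [← pow_succ', ← Matrix.mul_assoc]

theorem fromBlocks_zero_mulVec {ι κ R : Type*} [Fintype ι] [Fintype κ] [CommRing R]
    (D : Matrix ι ι R) (B : Matrix ι κ R) (w : ι ⊕ κ → R) :
    (fromBlocks D B 0 0 : Matrix (ι ⊕ κ) (ι ⊕ κ) R) *ᵥ w =
      Sum.elim (D *ᵥ (w ∘ Sum.inl) + B *ᵥ (w ∘ Sum.inr)) 0 := by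
  rw [fromBlocks_mulVec]
  simp

theorem map_ofReal_mulVec {p q : Type*} [Fintype q] (M : Matrix p q ℝ) (v : q → ℝ) :
    M.map Complex.ofReal *ᵥ (fun i => (v i : ℂ)) = fun i => ((M *ᵥ v) i : ℂ) := by
  ext i
  simp [mulVec, dotProduct]

theorem re_map_ofReal_mulVec {p q : Type*} [Fintype q] (M : Matrix p q ℝ) (v : q → ℂ) (i : p) :
    ((M.map Complex.ofReal *ᵥ v) i).re = (M *ᵥ fun j => (v j).re) i := by
  simp [mulVec, dotProduct]

end Matrix

namespace LinearSystem

/-! ### The kernel of the block rows -/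

section TestMatrix

variable {m k : ℕ} {ι : Type} [Fintype ι] [DecidableEq ι]

/-- Treating the input as an extra, constant state turns the test matrix into an observability
matrix. -/
theorem blockRow_eq_mul_pow (A : Matrix ι ι ℂ) (B : Matrix ι (Fin m) ℂ)
    (C : Matrix (Fin k) ι ℂ) (G : Matrix (Fin k) (Fin m) ℂ) (μ : ℂ) (j : ℕ) :
    blockRow A B C G μ j = fromCols C G *
      (fromBlocks (A - μ • 1) B 0 0 : Matrix (ι ⊕ Fin m) (ι ⊕ Fin m) ℂ) ^ j := by
  cases j with
  | zero => simp [blockRow]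
  | succ j =>
    rw [fromBlocks_zero_pow_succ, fromCols_mul_fromBlocks]
    simp [blockRow, Matrix.mul_assoc]

/-- By Cayley-Hamilton, the block rows of index at most `card ι` determine the others. -/
theorem blockRow_mulVec_eq_zero (A : Matrix ι ι ℂ) (B : Matrix ι (Fin m) ℂ)
    (C : Matrix (Fin k) ι ℂ) (G : Matrix (Fin k) (Fin m) ℂ) (μ : ℂ) (w : ι ⊕ Fin m → ℂ)
    (h : ∀ j ≤ Fintype.card ι, blockRow A B C G μ j *ᵥ w = 0) (j : ℕ) :
    blockRow A B C G μ j *ᵥ w = 0 := by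
  -- Beyond index 0 the rows observe one vector of the original state space, so `card ι` of them
  -- suffice, not `card ι + m`.
  have key : ∀ j, blockRow A B C G μ (j + 1) *ᵥ w =
      (C * (A - μ • 1) ^ j) *ᵥ ((A - μ • 1) *ᵥ (w ∘ Sum.inl) + B *ᵥ (w ∘ Sum.inr)) := by
    intro j
    rw [blockRow, fromCols_mulVec, mulVec_add, mulVec_mulVec, mulVec_mulVec, Matrix.mul_assoc C,
      Matrix.mul_assoc C, ← pow_succ]
  cases j with
  | zero => exact h 0 (Nat.zero_le _)
  | succ j =>
    rw [key]
    refine mul_pow_mulVec_eq_zero_of_lt_card _ _ _ (fun i hi => ?_) j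
    rw [← key]
    exact h _ hi

theorem blockRow_mulVec_eq_zero_of_eigen (A : Matrix ι ι ℂ) (B : Matrix ι (Fin m) ℂ)
    (C : Matrix (Fin k) ι ℂ) (G : Matrix (Fin k) (Fin m) ℂ) (μ : ℂ) (ξ : ι → ℂ) (v : Fin m → ℂ)
    (hA : A *ᵥ ξ + B *ᵥ v = μ • ξ) (hC : C *ᵥ ξ + G *ᵥ v = 0) (j : ℕ) :
    blockRow A B C G μ j *ᵥ Sum.elim ξ v = 0 := by
  rw [blockRow_eq_mul_pow]
  cases j with
  | zero => simpa [fromCols_mulVec] using hC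
  | succ j =>
    have h0 : (fromBlocks (A - μ • 1) B 0 0 : Matrix (ι ⊕ Fin m) (ι ⊕ Fin m) ℂ) *ᵥ
        Sum.elim ξ v = 0 := by
      rw [fromBlocks_zero_mulVec]
      have : (A - μ • 1) *ᵥ ξ + B *ᵥ v = 0 := by
        rw [sub_mulVec, smul_mulVec, one_mulVec, ← hA]
        abel
      simp [this]
    rw [pow_succ, ← Matrix.mul_assoc, ← mulVec_mulVec, h0, mulVec_zero]

variable {n₁ n₂ : ℕ}

theorem testMatrix_mulVec_eq_zero_iff (S₁ : LinearSystem n₁ m k) (S₂ : LinearSystem n₂ m k) (μ : ℂ)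
    (w : (Fin n₁ ⊕ Fin n₂) ⊕ Fin m → ℂ) :
    testMatrix S₁ S₂ μ *ᵥ w = 0 ↔
      ∀ j, blockRow ((jointA S₁ S₂).map Complex.ofReal) ((jointB S₁ S₂).map Complex.ofReal)
        ((jointC S₁ S₂).map Complex.ofReal) ((jointG S₁ S₂).map Complex.ofReal) μ j *ᵥ w = 0 := by
  constructor
  · refine fun h => blockRow_mulVec_eq_zero _ _ _ _ _ _ fun j hj => ?_
    ext i
    rw [Fintype.card_sum, Fintype.card_fin, Fintype.card_fin] at hj
    exact congrFun h (⟨j, Nat.lt_succ_of_le hj⟩, i)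
  · intro h
    ext p
    exact congrFun (h p.1) p.2

end TestMatrix

/-! ### Zero-output trajectories from kernel vectors -/

section Exponential

variable {ι κ : Type*} [Fintype ι] [DecidableEq ι]

/-- If `H Eʲ w = 0` for all `j`, then `w` is the initial value of a solution of `p' = (E + μ) p`
along which `H p` vanishes. -/
theorem exists_hasDerivAt_of_mul_pow_mulVec_eq_zero (E : Matrix ι ι ℂ) (H : Matrix κ ι ℂ) (μ : ℂ)
    (w : ι → ℂ) (h : ∀ j : ℕ, (H * E ^ j) *ᵥ w = 0) :
    ∃ p : ℝ → ι → ℂ, p 0 = w ∧ (∀ t, HasDerivAt p (μ • p t + E *ᵥ p t) t) ∧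
      ∀ t, H *ᵥ p t = 0 := by
  let _ : NormedRing (Matrix ι ι ℂ) := Matrix.linftyOpNormedRing
  let _ : NormedAlgebra ℂ (Matrix ι ι ℂ) := Matrix.linftyOpNormedAlgebra
  let _ : NormedAlgebra ℝ (Matrix ι ι ℂ) := Matrix.linftyOpNormedAlgebra
  let ev : Matrix ι ι ℂ →L[ℝ] (ι → ℂ) :=
    LinearMap.toContinuousLinearMap ((Matrix.mulVecBilin ℝ ℝ).flip w)
  -- The scalar factor undoes the shift by μ.
  refine ⟨fun t => Complex.exp (t * μ) • (NormedSpace.exp (t • E) *ᵥ w), ?_, fun t => ?_,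
    fun t => ?_⟩
  · simp
  · have h1 : HasDerivAt (fun t : ℝ => NormedSpace.exp (t • E) *ᵥ w)
        ((E * NormedSpace.exp (t • E)) *ᵥ w) t :=
      ev.hasFDerivAt.comp_hasDerivAt t (hasDerivAt_exp_smul_const' (𝕂 := ℝ) E t)
    have h2 : HasDerivAt (fun t : ℝ => Complex.exp (t * μ)) (Complex.exp (t * μ) * μ) t := by
      have : HasDerivAt (fun t : ℝ => (t : ℂ) * μ) μ t := by
        simpa using (Complex.ofRealCLM.hasDerivAt (x := t)).mul_const μ
      exact this.cexp
    refine (h2.smul h1).congr_deriv ?_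
    rw [mulVec_smul, mulVec_mulVec, smul_smul, mul_comm μ, add_comm]
  · have hs := NormedSpace.exp_series_hasSum_exp' (𝕂 := ℝ) (t • E)
    let ev' : Matrix ι ι ℂ →L[ℝ] (κ → ℂ) :=
      (LinearMap.toContinuousLinearMap (H.mulVecLin.restrictScalars ℝ)).comp ev
    have h3 := ev'.hasSum hs
    have h4 : ∀ j : ℕ, ev' (((Nat.factorial j)⁻¹ : ℝ) • (t • E) ^ j) = 0 := by
      intro j
      rw [map_smul, smul_pow, map_smul]
      have : ev' (E ^ j) = H *ᵥ (E ^ j *ᵥ w) := rfl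
      rw [this, mulVec_mulVec, h, smul_zero, smul_zero]
    have h5 : ev' (NormedSpace.exp (t • E)) = 0 := by
      refine h3.unique ?_
      simp only [h4]
      exact hasSum_zero
    change H *ᵥ (Complex.exp (t * μ) • (NormedSpace.exp (t • E) *ᵥ w)) = 0
    rw [mulVec_smul]
    have : H *ᵥ (NormedSpace.exp (t • E) *ᵥ w) = 0 := h5
    rw [this, smul_zero]

end Exponential

theorem exists_smul_re_ne_zero {ι : Type*} {w : ι → ℂ} (hw : w ≠ 0) :
    ∃ c : ℂ, (fun i => ((c • w) i).re) ≠ 0 := by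
  obtain ⟨i, hi⟩ := Function.ne_iff.mp hw
  by_cases hre : (w i).re = 0
  -- Multiplication by -i moves the imaginary part to the real part.
  · refine ⟨-Complex.I, fun h => hi ?_⟩
    have := congrFun h i
    simp at this
    exact Complex.ext hre this
  · refine ⟨1, fun h => hre ?_⟩
    simpa using congrFun h i

section Trajectory

variable {n n₁ n₂ m k : ℕ}

/-- A kernel vector of the block rows gives a real smooth trajectory with zero output. -/
theorem exists_trajectory_of_blockRow_mulVec_eq_zero {ι : Type} [Fintype ι] [DecidableEq ι]
    (A : Matrix ι ι ℝ) (B : Matrix ι (Fin m) ℝ) (C : Matrix (Fin k) ι ℝ)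
    (G : Matrix (Fin k) (Fin m) ℝ) (μ : ℂ) (w : ι ⊕ Fin m → ℂ) (hw : w ≠ 0)
    (h : ∀ j, blockRow (A.map Complex.ofReal) (B.map Complex.ofReal) (C.map Complex.ofReal)
      (G.map Complex.ofReal) μ j *ᵥ w = 0) :
    ∃ (x : ℝ → ι → ℝ) (u : ℝ → Fin m → ℝ), (x 0, u 0) ≠ 0 ∧ Continuous u ∧
      (∀ t, HasDerivAt x (A *ᵥ x t + B *ᵥ u t) t) ∧ ∀ t, C *ᵥ x t + G *ᵥ u t = 0 := by
  obtain ⟨c, hc⟩ := exists_smul_re_ne_zero hw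
  obtain ⟨p, hp0, hpd, hpH⟩ := exists_hasDerivAt_of_mul_pow_mulVec_eq_zero
    (fromBlocks (A.map Complex.ofReal - μ • 1) (B.map Complex.ofReal) 0 0)
    (fromCols (C.map Complex.ofReal) (G.map Complex.ofReal)) μ (c • w) fun j => by
      rw [← blockRow_eq_mul_pow, mulVec_smul, h, smul_zero]
  have hcont : Continuous p := continuous_iff_continuousAt.mpr fun t => (hpd t).continuousAt
  refine ⟨fun t i => (p t (Sum.inl i)).re, fun t i => (p t (Sum.inr i)).re, fun h0 => hc ?_,
    by fun_prop, fun t => ?_, fun t => ?_⟩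
  · rw [Prod.mk_eq_zero] at h0
    rw [← hp0]
    ext (i | i)
    · exact congrFun h0.1 i
    · exact congrFun h0.2 i
  · rw [hasDerivAt_pi]
    intro i
    have h1 := hasDerivAt_pi.mp (hpd t) (Sum.inl i)
    have h2 := Complex.reCLM.hasFDerivAt.comp_hasDerivAt t h1
    refine h2.congr_deriv ?_
    rw [fromBlocks_zero_mulVec, Pi.add_apply, Pi.add_apply]
    beta_reduce
    rw [← re_map_ofReal_mulVec, ← re_map_ofReal_mulVec]
    simp [sub_mulVec, smul_mulVec, Function.comp_def]
    ring
  · ext i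
    have h1 := congrArg Complex.re (congrFun (hpH t) i)
    rw [fromCols_mulVec, Pi.add_apply, Complex.add_re, re_map_ofReal_mulVec,
      re_map_ofReal_mulVec] at h1
    exact h1

theorem isSolution_of_hasDerivAt (S : LinearSystem n m k) {T : ℝ} (u : InputSpace T m)
    (v : ℝ → Fin m → ℝ) (hv : Continuous v) (huv : u =ᵐ[volume.restrict (Set.Icc 0 T)] v)
    (x : ℝ → Fin n → ℝ) (hx : ∀ t, HasDerivAt x (S.A *ᵥ x t + S.B *ᵥ v t) t) :
    S.IsSolution T (x 0) u x := by
  have hcont : Continuous x := continuous_iff_continuousAt.mpr fun t => (hx t).continuousAt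
  refine ⟨hcont.continuousOn, fun t ht => ?_⟩
  have h1 : ∫ s in (0 : ℝ)..t, (S.A *ᵥ x s + S.B *ᵥ u s) =
      ∫ s in (0 : ℝ)..t, (S.A *ᵥ x s + S.B *ᵥ v s) := by
    refine intervalIntegral.integral_congr_ae ?_
    filter_upwards [(ae_restrict_iff' measurableSet_Icc).mp huv] with s hs hst
    rw [Set.uIoc_of_le ht.1] at hst
    rw [hs ⟨hst.1.le, hst.2.trans ht.2⟩]
  rw [h1, intervalIntegral.integral_eq_sub_of_hasDerivAt (fun s _ => hx s)]
  · abel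
  · refine Continuous.intervalIntegrable ?_ _ _
    exact (continuous_const.matrix_mulVec hcont).add (continuous_const.matrix_mulVec hv)

theorem jointC_jointG_mulVec (S₁ : LinearSystem n₁ m k) (S₂ : LinearSystem n₂ m k)
    (x : Fin n₁ ⊕ Fin n₂ → ℝ) (v : Fin m → ℝ) :
    jointC S₁ S₂ *ᵥ x + jointG S₁ S₂ *ᵥ v =
      (S₁.C *ᵥ (x ∘ Sum.inl) + S₁.G *ᵥ v) - (S₂.C *ᵥ (x ∘ Sum.inr) + S₂.G *ᵥ v) := by
  rw [jointC, jointG, fromCols_mulVec, sub_mulVec, neg_mulVec]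
  abel

theorem jointA_jointB_mulVec (S₁ : LinearSystem n₁ m k) (S₂ : LinearSystem n₂ m k)
    (x : Fin n₁ ⊕ Fin n₂ → ℝ) (v : Fin m → ℝ) :
    jointA S₁ S₂ *ᵥ x + jointB S₁ S₂ *ᵥ v =
      Sum.elim (S₁.A *ᵥ (x ∘ Sum.inl) + S₁.B *ᵥ v) (S₂.A *ᵥ (x ∘ Sum.inr) + S₂.B *ᵥ v) := by
  rw [jointA, jointB, fromBlocks_mulVec, fromRows_mulVec]
  ext (i | i) <;> simp

theorem not_distinguishable_of_testMatrix_mulVec_eq_zero (S₁ : LinearSystem n₁ m k)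
    (S₂ : LinearSystem n₂ m k) {T : ℝ} (hT : 0 < T) (μ : ℂ) (w : (Fin n₁ ⊕ Fin n₂) ⊕ Fin m → ℂ)
    (hw : w ≠ 0) (h : testMatrix S₁ S₂ μ *ᵥ w = 0) : ¬ Distinguishable S₁ S₂ T := by
  intro hD
  obtain ⟨x, v, hne, hv, hx, hy⟩ := exists_trajectory_of_blockRow_mulVec_eq_zero _ _ _ _ μ w hw
    ((testMatrix_mulVec_eq_zero_iff S₁ S₂ μ w).mp h)
  have hmem : MemLp v 1 (volume.restrict (Set.Icc 0 T)) :=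
    memLp_one_iff_integrable.mpr (hv.continuousOn.integrableOn_compact isCompact_Icc)
  have huv : hmem.toLp v =ᵐ[volume.restrict (Set.Icc 0 T)] v := hmem.coeFn_toLp
  have hx₁ : ∀ t, HasDerivAt (fun t => x t ∘ Sum.inl)
      (S₁.A *ᵥ (x t ∘ Sum.inl) + S₁.B *ᵥ v t) t := fun t => by
    refine hasDerivAt_pi.mpr fun i => ?_
    have := hasDerivAt_pi.mp (hx t) (Sum.inl i)
    rwa [jointA_jointB_mulVec] at this
  have hx₂ : ∀ t, HasDerivAt (fun t => x t ∘ Sum.inr)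
      (S₂.A *ᵥ (x t ∘ Sum.inr) + S₂.B *ᵥ v t) t := fun t => by
    refine hasDerivAt_pi.mpr fun i => ?_
    have := hasDerivAt_pi.mp (hx t) (Sum.inr i)
    rwa [jointA_jointB_mulVec] at this
  refine hD (x 0 ∘ Sum.inl) (x 0 ∘ Sum.inr) (hmem.toLp v) (fun h0 => hne ?_) _ _
    (isSolution_of_hasDerivAt S₁ _ v hv huv _ hx₁)
    (isSolution_of_hasDerivAt S₂ _ v hv huv _ hx₂) ?_
  · simp only [Prod.mk_eq_zero] at h0 ⊢
    obtain ⟨h1, h2, h3⟩ := h0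
    refine ⟨?_, ?_⟩
    · ext (i | i)
      · exact congrFun h1 i
      · exact congrFun h2 i
    · have h4 : v =ᵐ[volume.restrict (Set.Icc 0 T)] fun _ => 0 := by
        refine huv.symm.trans ?_
        rw [h3]
        exact Lp.coeFn_zero _ _ _
      -- Continuity upgrades vanishing almost everywhere to vanishing at 0.
      exact Measure.eqOn_Icc_of_ae_eq volume hT.ne h4 hv.continuousOn continuousOn_const
        ⟨le_rfl, hT.le⟩
  · filter_upwards [huv] with t ht
    have := hy t
    rw [jointC_jointG_mulVec, sub_eq_zero] at this
    rw [output, output, ht]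
    exact this

/-! ### Kernel vectors from zero-output trajectories -/

/-- A nonzero controlled invariant subspace on which the output can be kept at zero contains an
eigenvector of a closed loop. -/
theorem exists_eigen_of_controlledInvariant {ι κ l : Type*} [Fintype ι] [Fintype κ]
    (A : Matrix ι ι ℂ) (B : Matrix ι κ ℂ) (C : Matrix l ι ℂ) (G : Matrix l κ ℂ)
    (V : Submodule ℂ (ι → ℂ)) (hV : V ≠ ⊥)
    (h : ∀ ξ ∈ V, ∃ v, A *ᵥ ξ + B *ᵥ v ∈ V ∧ C *ᵥ ξ + G *ᵥ v = 0) :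
    ∃ (μ : ℂ) (ξ : ι → ℂ) (v : κ → ℂ), ξ ≠ 0 ∧ A *ᵥ ξ + B *ᵥ v = μ • ξ ∧
      C *ᵥ ξ + G *ᵥ v = 0 := by
  have : Nontrivial V := Submodule.nontrivial_iff_ne_bot.mpr hV
  let b := Module.finBasis ℂ V
  choose f hf using fun i => h (b i) (b i).2
  -- Choosing inputs only on a basis makes the feedback linear.
  let F : V →ₗ[ℂ] (κ → ℂ) := b.constr ℂ f
  let L : V →ₗ[ℂ] (ι → ℂ) := A.mulVecLin ∘ₗ V.subtype + B.mulVecLin ∘ₗ F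
  have hL : ∀ ξ, L ξ ∈ V := by
    suffices h' : (⊤ : Submodule ℂ V) ≤ V.comap L from fun ξ => h' trivial
    rw [← b.span_eq, Submodule.span_le]
    rintro _ ⟨i, rfl⟩
    simpa [L, F] using (hf i).1
  have hC : C.mulVecLin ∘ₗ V.subtype + G.mulVecLin ∘ₗ F = 0 :=
    b.ext fun i => by simpa [F] using (hf i).2
  obtain ⟨μ, hμ⟩ := Module.End.exists_eigenvalue (L.codRestrict V hL)
  obtain ⟨ξ, hξ⟩ := hμ.exists_hasEigenvector
  refine ⟨μ, ξ, F ξ, fun h0 => hξ.2 (Subtype.ext h0), congrArg Subtype.val hξ.apply_eq_smul,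
    LinearMap.congr_fun hC ξ⟩

theorem _root_.HasDerivAt.mem_of_eventually_mem {F : Type*} [NormedAddCommGroup F] [NormedSpace ℝ F]
    {x : ℝ → F} {x' : F} {t : ℝ} (V : Submodule ℝ F) (hV : IsClosed (V : Set F))
    (hx : HasDerivAt x x' t) (h : ∀ᶠ s in 𝓝 t, x s ∈ V) : x' ∈ V := by
  refine hV.mem_of_tendsto (hasDerivAt_iff_tendsto_slope.mp hx) ?_
  filter_upwards [h.filter_mono nhdsWithin_le_nhds] with s hs
  exact V.smul_mem _ (V.sub_mem hs h.self_of_nhds)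

/-- A function that is continuous on `[a,b]` and almost everywhere in a closed set stays in it. -/
theorem _root_.ContinuousOn.mem_of_ae_mem_Icc {F : Type*} [PseudoMetricSpace F] {a b : ℝ}
    (hab : a ≠ b) {z : ℝ → F} {W : Set F} (hz : ContinuousOn z (Set.Icc a b)) (hW : IsClosed W)
    (hne : W.Nonempty) (h : ∀ᵐ t ∂volume.restrict (Set.Icc a b), z t ∈ W) :
    ∀ t ∈ Set.Icc a b, z t ∈ W := by
  intro t ht
  rw [hW.mem_iff_infDist_zero hne]
  refine Measure.eqOn_Icc_of_ae_eq (g := fun _ => (0 : ℝ)) volume hab ?_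
    ((Metric.continuous_infDist_pt W).comp_continuousOn hz) continuousOn_const ht
  filter_upwards [h] with s hs using Metric.infDist_zero_of_mem hs

/-- The complex span of an output-zeroing trajectory is controlled invariant. -/
theorem exists_input_of_mem_span_trajectory {ι κ l : Type*} [Fintype ι] [Fintype κ] [Fintype l]
    (A : Matrix ι ι ℝ) (B : Matrix ι κ ℝ) (C : Matrix l ι ℝ) (G : Matrix l κ ℝ) {T : ℝ}
    (hT : 0 < T) (x : ℝ → ι → ℝ) (u : ℝ → κ → ℝ) (hx : ContinuousOn x (Set.Icc 0 T))
    (hd : ∀ᵐ t ∂volume.restrict (Set.Icc 0 T), HasDerivAt x (A *ᵥ x t + B *ᵥ u t) t)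
    (hy : ∀ᵐ t ∂volume.restrict (Set.Icc 0 T), C *ᵥ x t + G *ᵥ u t = 0)
    (ξ : ι → ℂ) (hξ : ξ ∈ Submodule.span ℂ ((fun t i => (x t i : ℂ)) '' Set.Icc 0 T)) :
    ∃ v, A.map Complex.ofReal *ᵥ ξ + B.map Complex.ofReal *ᵥ v ∈
        Submodule.span ℂ ((fun t i => (x t i : ℂ)) '' Set.Icc 0 T) ∧
      C.map Complex.ofReal *ᵥ ξ + G.map Complex.ofReal *ᵥ v = 0 := by
  set z : ℝ → ι → ℂ := fun t i => (x t i : ℂ) with hz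
  set V := Submodule.span ℂ (z '' Set.Icc 0 T) with hVdef
  have hmem : ∀ t ∈ Set.Icc 0 T, z t ∈ V := fun t ht => Submodule.subset_span ⟨t, ht, rfl⟩
  -- The admissible states form a subspace, so it is enough to treat the generators of V.
  let W : Submodule ℂ (ι → ℂ) :=
    { carrier := {ξ | ∃ v, A.map Complex.ofReal *ᵥ ξ + B.map Complex.ofReal *ᵥ v ∈ V ∧
        C.map Complex.ofReal *ᵥ ξ + G.map Complex.ofReal *ᵥ v = 0}
      zero_mem' := ⟨0, by simp, by simp⟩
      add_mem' := by
        rintro a b ⟨v, hv, hv'⟩ ⟨w, hw, hw'⟩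
        refine ⟨v + w, ?_, ?_⟩
        · rw [mulVec_add, mulVec_add, add_add_add_comm]
          exact V.add_mem hv hw
        · rw [mulVec_add, mulVec_add, add_add_add_comm, hv', hw', add_zero]
      smul_mem' := by
        rintro c a ⟨v, hv, hv'⟩
        refine ⟨c • v, ?_, ?_⟩
        · rw [mulVec_smul, mulVec_smul, ← smul_add]
          exact V.smul_mem c hv
        · rw [mulVec_smul, mulVec_smul, ← smul_add, hv', smul_zero] }
  suffices hVW : V ≤ W from hVW hξ
  have hzc : ContinuousOn z (Set.Icc 0 T) :=
    continuousOn_pi.mpr fun i =>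
      Complex.continuous_ofReal.comp_continuousOn (continuousOn_pi.mp hx i)
  have hae : ∀ᵐ t ∂volume.restrict (Set.Icc 0 T), z t ∈ W := by
    -- At interior times x stays in V nearby, hence so does its derivative.
    rw [← Measure.restrict_congr_set Ioo_ae_eq_Icc] at hd hy ⊢
    filter_upwards [hd, hy, ae_restrict_mem measurableSet_Ioo] with t h1 h2 ht
    refine ⟨fun i => (u t i : ℂ), ?_, ?_⟩
    · have h3 : HasDerivAt z (fun i => ((A *ᵥ x t + B *ᵥ u t) i : ℂ)) t :=
        hasDerivAt_pi.mpr fun i => (hasDerivAt_pi.mp h1 i).ofReal_comp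
      have h4 := h3.mem_of_eventually_mem (V.restrictScalars ℝ) V.closed_of_finiteDimensional (by
        filter_upwards [Icc_mem_nhds ht.1 ht.2] with s hs using hmem s hs)
      simp only [hz, map_ofReal_mulVec]
      rw [Submodule.restrictScalars_mem] at h4
      convert h4 using 1
      ext i
      simp
    · simp only [hz, map_ofReal_mulVec]
      ext i
      simpa using congrArg Complex.ofReal (congrFun h2 i)
  rw [hVdef, Submodule.span_le]
  rintro _ ⟨t, ht, rfl⟩
  exact hzc.mem_of_ae_mem_Icc hT.ne W.closed_of_finiteDimensional ⟨0, W.zero_mem⟩ hae t ht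

/-- Lebesgue differentiation of the integrated equation, at interior times. -/
theorem IsSolution.ae_hasDerivAt {S : LinearSystem n m k} {T : ℝ} (hT : 0 < T) {x₀ : Fin n → ℝ}
    {u : InputSpace T m} {x : ℝ → Fin n → ℝ} (h : S.IsSolution T x₀ u x) :
    ∀ᵐ t ∂volume.restrict (Set.Icc 0 T), HasDerivAt x (S.A *ᵥ x t + S.B *ᵥ u t) t := by
  have hx : IntegrableOn (fun t => S.A *ᵥ x t) (Set.Icc 0 T) :=
    (S.A.mulVecLin.toContinuousLinearMap.continuous.comp_continuousOn
      h.1).integrableOn_compact isCompact_Icc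
  have hu : IntegrableOn (fun t => S.B *ᵥ u t) (Set.Icc 0 T) :=
    S.B.mulVecLin.toContinuousLinearMap.integrable_comp (L1.integrable_coeFn u)
  have hf : IntervalIntegrable (fun t => S.A *ᵥ x t + S.B *ᵥ u t) volume 0 T :=
    (intervalIntegrable_iff_integrableOn_Icc_of_le hT.le).mpr (hx.add hu)
  refine (Measure.restrict_congr_set Ioo_ae_eq_Icc).symm.le.absolutelyContinuous.ae_le
    ((ae_restrict_iff' measurableSet_Ioo).mpr ?_)
  filter_upwards [hf.ae_hasDerivAt_integral] with t hd ht
  rw [Set.uIcc_of_le hT.le] at hd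
  refine ((hd ⟨ht.1.le, ht.2.le⟩ 0 ⟨le_rfl, hT.le⟩).const_add x₀).congr_of_eventuallyEq ?_
  filter_upwards [Icc_mem_nhds ht.1 ht.2] with s hs using h.2 s hs

theorem IsSolution.apply_zero {S : LinearSystem n m k} {T : ℝ} (hT : 0 < T) {x₀ : Fin n → ℝ}
    {u : InputSpace T m} {x : ℝ → Fin n → ℝ} (h : S.IsSolution T x₀ u x) : x 0 = x₀ := by
  simpa using h.2 0 ⟨le_rfl, hT.le⟩

/-- A nonzero output-zeroing `L¹` trajectory forces the Rosenbrock pencil to be singular somewhere. -/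
theorem exists_eigen_of_trajectory {ι κ l : Type*} [Fintype ι] [Fintype κ] [Fintype l]
    (A : Matrix ι ι ℝ) (B : Matrix ι κ ℝ) (C : Matrix l ι ℝ) (G : Matrix l κ ℝ) {T : ℝ}
    (hT : 0 < T) (x : ℝ → ι → ℝ) (u : ℝ → κ → ℝ) (hx : ContinuousOn x (Set.Icc 0 T))
    (hd : ∀ᵐ t ∂volume.restrict (Set.Icc 0 T), HasDerivAt x (A *ᵥ x t + B *ᵥ u t) t)
    (hy : ∀ᵐ t ∂volume.restrict (Set.Icc 0 T), C *ᵥ x t + G *ᵥ u t = 0)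
    (hne : ¬ (x 0 = 0 ∧ u =ᵐ[volume.restrict (Set.Icc 0 T)] 0)) :
    ∃ (μ : ℂ) (ξ : ι → ℂ) (v : κ → ℂ), (ξ, v) ≠ 0 ∧
      A.map Complex.ofReal *ᵥ ξ + B.map Complex.ofReal *ᵥ v = μ • ξ ∧
      C.map Complex.ofReal *ᵥ ξ + G.map Complex.ofReal *ᵥ v = 0 := by
  by_cases hV : Submodule.span ℂ ((fun t i => (x t i : ℂ)) '' Set.Icc 0 T) = ⊥
  · have hx0 : ∀ t ∈ Set.Icc 0 T, x t = 0 := fun t ht => by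
      have h0 := Submodule.span_eq_bot.mp hV _ ⟨t, ht, rfl⟩
      ext i
      simpa using congrFun h0 i
    have hu : ∃ᵐ t ∂volume.restrict (Set.Icc 0 T), u t ≠ 0 := fun h =>
      hne ⟨hx0 0 ⟨le_rfl, hT.le⟩, h.mono fun t ht => not_not.mp ht⟩
    have hBG : ∀ᵐ t ∂volume.restrict (Set.Icc 0 T), B *ᵥ u t = 0 ∧ G *ᵥ u t = 0 := by
      rw [← Measure.restrict_congr_set Ioo_ae_eq_Icc] at hd hy ⊢
      filter_upwards [hd, hy, ae_restrict_mem measurableSet_Ioo] with t h1 h2 ht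
      have h3 := hx0 t ⟨ht.1.le, ht.2.le⟩
      rw [h3, mulVec_zero, zero_add] at h1 h2
      refine ⟨h1.unique ((hasDerivAt_const t (0 : ι → ℝ)).congr_of_eventuallyEq ?_), h2⟩
      filter_upwards [Icc_mem_nhds ht.1 ht.2] with s hs using hx0 s hs
    obtain ⟨t, ht, hB, hG⟩ := (hu.and_eventually hBG).exists
    -- With ξ = 0 any μ would do.
    refine ⟨0, 0, fun i => (u t i : ℂ), fun h0 => ht ?_, ?_, ?_⟩
    · ext i
      simpa using congrFun (Prod.mk_eq_zero.mp h0).2 i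
    · rw [map_ofReal_mulVec, hB]
      ext i
      simp
    · rw [map_ofReal_mulVec, hG]
      ext i
      simp
  · obtain ⟨μ, ξ, v, hξ, h1, h2⟩ := exists_eigen_of_controlledInvariant _ _ _ _ _ hV
      (exists_input_of_mem_span_trajectory A B C G hT x u hx hd hy)
    exact ⟨μ, ξ, v, fun h0 => hξ (Prod.mk_eq_zero.mp h0).1, h1, h2⟩

theorem exists_testMatrix_mulVec_eq_zero_of_not_distinguishable (S₁ : LinearSystem n₁ m k)
    (S₂ : LinearSystem n₂ m k) {T : ℝ} (hT : 0 < T) (h : ¬ Distinguishable S₁ S₂ T) :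
    ∃ μ w, w ≠ 0 ∧ testMatrix S₁ S₂ μ *ᵥ w = 0 := by
  simp only [Distinguishable, not_forall, not_not] at h
  obtain ⟨x₁₀, x₂₀, u, hne, x₁, x₂, h₁, h₂, hy⟩ := h
  obtain ⟨μ, ξ, v, hξv, hA, hC⟩ := exists_eigen_of_trajectory (jointA S₁ S₂) (jointB S₁ S₂)
    (jointC S₁ S₂) (jointG S₁ S₂) hT (fun t => Sum.elim (x₁ t) (x₂ t)) u
    (continuousOn_pi.mpr (Sum.rec (continuousOn_pi.mp h₁.1) (continuousOn_pi.mp h₂.1)))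
    (by
      filter_upwards [h₁.ae_hasDerivAt hT, h₂.ae_hasDerivAt hT] with t hd₁ hd₂
      rw [jointA_jointB_mulVec]
      exact hasDerivAt_pi.mpr (Sum.rec (hasDerivAt_pi.mp hd₁) (hasDerivAt_pi.mp hd₂)))
    (by
      filter_upwards [hy] with t ht
      rw [jointC_jointG_mulVec, sub_eq_zero]
      exact ht)
    (by
      rintro ⟨h0, hu⟩
      refine hne ?_
      have e₁ : x₁₀ = 0 := by
        rw [← h₁.apply_zero hT]
        ext i
        exact congrFun h0 (Sum.inl i)
      have e₂ : x₂₀ = 0 := by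
        rw [← h₂.apply_zero hT]
        ext i
        exact congrFun h0 (Sum.inr i)
      rw [e₁, e₂, (Lp.eq_zero_iff_ae_eq_zero (f := u)).mpr hu]
      rfl)
  refine ⟨μ, Sum.elim ξ v, fun h0 => hξv (Prod.mk_eq_zero.mpr ⟨?_, ?_⟩),
    (testMatrix_mulVec_eq_zero_iff S₁ S₂ μ _).mpr
      (blockRow_mulVec_eq_zero_of_eigen _ _ _ _ μ ξ v hA hC)⟩
  · ext i
    exact congrFun h0 (Sum.inl i)
  · ext i
    exact congrFun h0 (Sum.inr i)

end Trajectory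

end LinearSystem

theorem theorem4p2 {n₁ n₂ m k : ℕ} (hn₁ : 1 ≤ n₁) (hn₂ : 1 ≤ n₂) (hm : 1 ≤ m) (hk : 1 ≤ k)
    (S₁ : LinearSystem n₁ m k) (S₂ : LinearSystem n₂ m k) (T : ℝ) (hT : 0 < T) :
    LinearSystem.Distinguishable S₁ S₂ T ↔
      ∀ μ : ℂ, (LinearSystem.testMatrix S₁ S₂ μ).rank = n₁ + n₂ + m := by
  have hcard : n₁ + n₂ + m = Fintype.card ((Fin n₁ ⊕ Fin n₂) ⊕ Fin m) := by simp
  simp only [hcard, Matrix.rank_eq_card_iff_forall_mulVec_eq_zero]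
  constructor
  · intro hD μ w hw
    by_contra hne
    exact LinearSystem.not_distinguishable_of_testMatrix_mulVec_eq_zero S₁ S₂ hT μ w hne hw hD
  · intro h
    by_contra hD
    obtain ⟨μ, w, hne, hw⟩ :=
      LinearSystem.exists_testMatrix_mulVec_eq_zero_of_not_distinguishable S₁ S₂ hT hD
    exact hne (h μ w hw)
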